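/- Let $\mathcal F$ be the class of continuous distribution functions $F$ on $\mathbb R$ with $F(0)=0$ that have a density $f$ which is the sum of its Maclaurin series at every $x>0$, i.e. $f(x)=\sum_{q\ge 0} f^{(q)}(0)\,x^q/q!$ for all $x>0$ (with right-hand derivatives at $0$). Let $n\ge 2$ and let $X_1,\dots,X_n$ be independent random variables with common distribution function $F\in\mathcal F$. Fix an integer $k$ with $1\le k\le n$, and let $X_{(k;n)}$ denote the $k$-th order statistic, i.e. the $k$-th smallest among $X_1,\dots,X_n$. If $$\frac{1}{n}X_1+\frac{1}{n-1}X_2+\cdots+\frac{1}{n-k+1}X_k\ \overset{d}{=}\ X_{(k;n)},$$ then $F$ is the distribution function of an exponential distribution with some rate $\lambda>0$, i.e. $F(x)=1-e^{-\lambda x}$ for all $x\ge 0$. -/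

import Mathlib

open MeasureTheory ProbabilityTheory

/-- The law `μ` on `ℝ` has a distribution function `F` that is continuous, satisfies `F 0 = 0`, and
has a density `f` that is the sum of its Maclaurin series at every `x > 0`.
(The coefficient `a q` is then necessarily the `q`-th right derivative of `f` at `0`, divided
by `q!`; the derivatives at `0` are one-sided, since `f` vanishes on the negative half-line.) -/
structure HasMaclaurinDensity (μ : Measure ℝ) : Prop where
  continuous_cdf : Continuous (cdf μ)
  cdf_zero : cdf μ 0 = 0
  density : ∃ f : ℝ → ℝ, Measurable f ∧ (∀ x, 0 ≤ f x) ∧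
    μ = volume.withDensity (fun x => ENNReal.ofReal (f x)) ∧
    ∃ a : ℕ → ℝ, ∀ x : ℝ, 0 < x → HasSum (fun q : ℕ => a q * x ^ q) (f x)

/-- The order statistics of a finite sample: `orderStatistic x i` is the entry at the zero-based
position `i` of the increasing rearrangement of `x`, so `i = 0` gives the minimum and the `k`-th
smallest value has `i = k - 1`. -/
noncomputable def orderStatistic {n : ℕ} (x : Fin n → ℝ) (i : Fin n) : ℝ :=
  x (Tuple.sort x i)

/-! Encode the density by the formal series `Φ` of its derivatives at `0`, so that the density is
the Borel transform of `Φ`. Convolution on the half-line becomes the product `A * (X * B)`, and the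
distribution function of the `k`-th order statistic is the binomial tail polynomial evaluated at
`F`. Since a power series is determined by its values at positive reals
(`HasMaclaurinSeries.unique`), the hypothesis becomes an identity of formal series in `Φ`.

That identity is rigid. If `Φ` vanished at `0`, comparing lowest-order terms would give an equation
between factorials, excluded by `descFactorial_pow_mul_ne_factorial`. If two solutions with the same
nonzero value at `0` first differed in degree `m`, comparing coefficients in degree `k + m` would
force `∑ (n - i) ^ m` over `i < k` to equal `(m + k).choose (m + 1)`; by `choose_lt_sum_pow` this
fails unless `k = n` and `m = 1`.

Exponential functions supply enough solutions to match these data: `a * exp (-a x)` for every `k`,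
and `a * exp (ρ x)` with `ρ` free when `k = n`. Hence the density is `a * exp (ρ x)`, and total mass
one forces `ρ < 0` and `a = -ρ`. -/

open scoped Nat

/-! ### Binomial and factorial arithmetic. -/

theorem choose_add_le_succ_pow (i m : ℕ) : (m + i).choose m ≤ (i + 1) ^ m := by
  induction m with
  | zero => simp
  | succ m ih =>
    have h := Nat.add_one_mul_choose_eq (m + i) m
    have h1 : (m + 1 + i).choose (m + 1) * (m + 1) ≤ (i + 1) ^ (m + 1) * (m + 1) := by
      rw [show m + 1 + i = m + i + 1 by omega, ← h]
      calc (m + i + 1) * (m + i).choose m ≤ ((i + 1) * (m + 1)) * (i + 1) ^ m :=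
            Nat.mul_le_mul (by nlinarith) ih
        _ = _ := by ring
    exact Nat.le_of_mul_le_mul_right h1 (Nat.succ_pos m)

theorem sum_choose_add_eq (m k : ℕ) :
    ∑ i ∈ Finset.range k, (m + i).choose m = (m + k).choose (m + 1) := by
  induction k with
  | zero => simp
  | succ k ih => rw [Finset.sum_range_succ, ih, ← Nat.add_assoc, Nat.choose_succ_succ, add_comm]

/-- By the hockey-stick identity both sides are sums of `k` terms; after reversing one of them, `(m
+ i).choose m ≤ (i + 1) ^ m ≤ (n - k + 1 + i) ^ m`. Every term is strict if `k < n`; if `k = n`, the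
term `i = 1` is strict because `m + 1 < 2 ^ m` for `m ≥ 2`. The excluded case `k = n`, `m = 1` is an
equality. -/
theorem choose_lt_sum_pow {n k m : ℕ} (hn : 2 ≤ n) (hk : 1 ≤ k) (hkn : k ≤ n) (hm : 1 ≤ m)
    (h : k < n ∨ 2 ≤ m) :
    (m + k).choose (m + 1) < ∑ i ∈ Finset.range k, (n - i) ^ m := by
  rw [← sum_choose_add_eq, ← Finset.sum_range_reflect (fun i => (n - i) ^ m)]
  have hle : ∀ i ∈ Finset.range k, (m + i).choose m ≤ (n - (k - 1 - i)) ^ m := fun i hi =>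
    (choose_add_le_succ_pow i m).trans
      (Nat.pow_le_pow_left (by have := Finset.mem_range.1 hi; omega) m)
  rcases h with h | h
  · refine Finset.sum_lt_sum_of_nonempty ⟨0, Finset.mem_range.2 (by omega)⟩ fun i hi => ?_
    exact (choose_add_le_succ_pow i m).trans_lt
      (Nat.pow_lt_pow_left (by have := Finset.mem_range.1 hi; omega) (by omega))
  · rcases hkn.lt_or_eq with h' | rfl
    · refine Finset.sum_lt_sum_of_nonempty ⟨0, Finset.mem_range.2 (by omega)⟩ fun i hi => ?_
      exact (choose_add_le_succ_pow i m).trans_lt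
        (Nat.pow_lt_pow_left (by have := Finset.mem_range.1 hi; omega) (by omega))
    · refine Finset.sum_lt_sum hle ⟨1, Finset.mem_range.2 (by omega), ?_⟩
      rw [Nat.choose_succ_self_right, show k - (k - 1 - 1) = 2 by omega]
      clear hle hk hkn
      induction m, h using Nat.le_induction with
      | base => norm_num
      | succ m hm ih => rw [pow_succ]; have := ih (by omega); omega

theorem two_pow_mul_factorial_mul_odd (k : ℕ) : ∃ a, Odd a ∧ (2 * k)! = 2 ^ k * k ! * a := by
  induction k with
  | zero => exact ⟨1, odd_one, by simp⟩
  | succ k ih =>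
    obtain ⟨a, ha, h⟩ := ih
    refine ⟨(2 * k + 1) * a, (odd_two_mul_add_one k).mul ha, ?_⟩
    rw [show 2 * (k + 1) = 2 * k + 1 + 1 by ring, Nat.factorial_succ, Nat.factorial_succ, h,
      Nat.factorial_succ]
    ring

/-- For `k = 1` the equation reads `n ^ m = 1`. For `m = 1` it makes the descending factorial odd,
although it is divisible by `k !` with `k ≥ 2`. Otherwise a Bertrand prime gives a contradiction of
valuations. -/
theorem descFactorial_pow_mul_ne_factorial {n k m : ℕ} (hn : 2 ≤ n) (hk : 1 ≤ k) (hkn : k ≤ n)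
    (hm : 1 ≤ m) : n.descFactorial k ^ m * (m + 1)! ^ k * k ! ≠ (k * (m + 1))! := by
  intro h
  rcases hk.eq_or_lt with rfl | hk2
  · rw [Nat.descFactorial_one, pow_one, Nat.factorial_one, mul_one, one_mul] at h
    have h1 : n ^ m = 1 := by
      have := (m + 1).factorial_pos
      nlinarith
    have := Nat.one_lt_pow (by omega : m ≠ 0) (by omega : 1 < n)
    omega
  rcases hm.eq_or_lt with rfl | hm2
  · obtain ⟨a, ha, h2⟩ := two_pow_mul_factorial_mul_odd k
    rw [show k * (1 + 1) = 2 * k by ring, h2, pow_one] at h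
    have h3 : n.descFactorial k = a := by
      have h4 : 0 < 2 ^ k * k ! := by positivity
      refine Nat.eq_of_mul_eq_mul_left h4 ?_
      rw [← h]; norm_num; ring
    have h5 : 2 ∣ n.descFactorial k :=
      (Nat.dvd_factorial (by norm_num) hk2).trans (Nat.factorial_dvd_descFactorial n k)
    rw [h3] at h5
    exact (Nat.not_even_iff_odd.2 ha) (even_iff_two_dvd.2 h5)
  · have hkm : 2 * k ≤ k * (m + 1) := by nlinarith
    have hkm' : 2 * (m + 1) ≤ k * (m + 1) := Nat.mul_le_mul_right _ hk2
    -- This prime exceeds both `k` and `m + 1` and divides the right-hand factorial exactly once,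
    -- whereas its exponent on the left is a multiple of `m ≥ 2`.
    obtain ⟨p, hp, hlt, hle⟩ :=
      Nat.exists_prime_lt_and_le_two_mul (k * (m + 1) / 2) (by omega)
    have hv := congrArg (fun N => N.factorization p) h
    have hk! : (k !).factorization p = 0 :=
      Nat.factorization_eq_zero_of_not_dvd (fun hd => by have := (hp.dvd_factorial).1 hd; omega)
    have hm! : ((m + 1)!).factorization p = 0 :=
      Nat.factorization_eq_zero_of_not_dvd (fun hd => by have := (hp.dvd_factorial).1 hd; omega)
    have hD : n.descFactorial k ≠ 0 := by
      rw [Ne, Nat.descFactorial_eq_zero_iff_lt]; omega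
    have hbig : ((k * (m + 1))!).factorization p = 1 := by
      have hlog : Nat.log p (k * (m + 1)) < 2 :=
        Nat.log_lt_of_lt_pow (by omega) (by nlinarith [hp.two_le, (by omega : k * (m + 1) < 2 * p)])
      rw [Nat.factorization_factorial hp hlog]
      simpa using Nat.div_eq_of_lt_le (by omega) (by omega)
    simp only [hbig] at hv
    rw [Nat.factorization_mul (by positivity) (by positivity),
      Nat.factorization_mul (by positivity) (by positivity), Nat.factorization_pow,
      Nat.factorization_pow] at hv
    simp only [Finsupp.add_apply, Finsupp.smul_apply, hk!, hm!, smul_eq_mul, mul_zero,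
      add_zero] at hv
    have := Nat.eq_one_of_mul_eq_one_right hv
    omega

/-! ### The formal identity and its solutions. -/

open PowerSeries in
/-- The formal Borel transform `∑ aₙ Xⁿ ↦ ∑ aₙ / n! Xⁿ`. -/
noncomputable def borelTransform (A : ℝ⟦X⟧) : ℝ⟦X⟧ := PowerSeries.mk fun q => coeff q A / q !

/-- The polynomial whose value at `p` is the probability that a binomial random variable with
parameters `n` and `p` is at least `k`. -/
noncomputable def binomialTail (n k : ℕ) : Polynomial ℝ :=
  ∑ j ∈ Finset.Ico k (n + 1), bernsteinPolynomial ℝ n j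

open PowerSeries in
/-- If `Φ` collects the derivatives at `0` of a density on the positive half-line, this series
collects those of the density of the variable divided by `c`. -/
noncomputable def scaleDensity (c : ℝ) (Φ : ℝ⟦X⟧) : ℝ⟦X⟧ := C c * rescale c Φ

section FormalSeries

open PowerSeries

theorem coeff_borelTransform (A : ℝ⟦X⟧) (q : ℕ) : coeff q (borelTransform A) = coeff q A / q ! := by
  simp [borelTransform]

theorem borelTransform_C_mul (r : ℝ) (A : ℝ⟦X⟧) :
    borelTransform (C r * A) = C r * borelTransform A := by
  ext q; simp [coeff_borelTransform, mul_div_assoc]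

theorem borelTransform_add (A B : ℝ⟦X⟧) :
    borelTransform (A + B) = borelTransform A + borelTransform B := by
  ext q; simp [coeff_borelTransform, add_div]

theorem borelTransform_sub (A B : ℝ⟦X⟧) :
    borelTransform (A - B) = borelTransform A - borelTransform B := by
  ext q; simp [coeff_borelTransform, sub_div]

theorem borelTransform_one : borelTransform 1 = 1 := by
  ext q
  rw [coeff_borelTransform, coeff_one]
  split_ifs with h <;> simp [h]

/-- Under the Borel transform, multiplication by `X` is integration from `0`. -/
theorem derivative_borelTransform_X_mul (A : ℝ⟦X⟧) :
    d⁄dX ℝ (borelTransform (X * A)) = borelTransform A := by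
  ext q
  rw [coeff_derivative, coeff_borelTransform, coeff_borelTransform, coeff_succ_X_mul,
    Nat.factorial_succ]
  have : (q ! : ℝ) ≠ 0 := by positivity
  push_cast
  field_simp

theorem constantCoeff_borelTransform_X_mul (A : ℝ⟦X⟧) :
    constantCoeff (borelTransform (X * A)) = 0 := by
  rw [← coeff_zero_eq_constantCoeff_apply, coeff_borelTransform]; simp

theorem coeff_X_pow_mul_self (m : ℕ) (A : ℝ⟦X⟧) : coeff m (X ^ m * A) = constantCoeff A := by
  simpa using coeff_X_pow_mul A m 0

theorem X_pow_dvd_borelTransform {m : ℕ} {A : ℝ⟦X⟧} (h : X ^ m ∣ A) : X ^ m ∣ borelTransform A := by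
  rw [X_pow_dvd_iff] at h ⊢
  intro q hq
  rw [coeff_borelTransform, h q hq, zero_div]

theorem binomialTail_zero (n : ℕ) : binomialTail n 0 = 1 := by
  rw [binomialTail, ← Finset.range_eq_Ico, bernsteinPolynomial.sum]

theorem binomialTail_eq_add {n k : ℕ} (h : k ≤ n) :
    binomialTail n k = bernsteinPolynomial ℝ n k + binomialTail n (k + 1) :=
  Finset.sum_eq_sum_Ico_succ_bot (by omega) _

theorem binomialTail_self (n : ℕ) : binomialTail n n = Polynomial.X ^ n := by
  simp [binomialTail, bernsteinPolynomial]

theorem exists_binomialTail_eq_mul {n k : ℕ} (h : k ≤ n) :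
    ∃ W : Polynomial ℝ, binomialTail n k = Polynomial.X ^ k * W ∧ W.eval 0 = n.choose k := by
  rw [binomialTail_eq_add h]
  have h2 : (Polynomial.X : Polynomial ℝ) ^ (k + 1) ∣ binomialTail n (k + 1) := by
    refine Finset.dvd_sum fun j hj => ?_
    rw [bernsteinPolynomial, mul_assoc]
    exact ((pow_dvd_pow _ (Finset.mem_Ico.1 hj).1).mul_right _).mul_left _
  obtain ⟨V, hV⟩ := h2
  refine ⟨(n.choose k : Polynomial ℝ) * (1 - Polynomial.X) ^ (n - k) + Polynomial.X * V, ?_, ?_⟩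
  · rw [hV, bernsteinPolynomial]; ring
  · simp

theorem derivative_binomialTail_succ {n k : ℕ} (h : k < n) :
    Polynomial.derivative (binomialTail n (k + 1)) = n * bernsteinPolynomial ℝ (n - 1) k := by
  induction k with
  | zero =>
    have h1 := congrArg Polynomial.derivative (binomialTail_eq_add (Nat.zero_le n))
    rw [binomialTail_zero, Polynomial.derivative_add, bernsteinPolynomial.derivative_zero,
      Polynomial.derivative_one] at h1
    linear_combination -h1
  | succ k ih =>
    have h1 := congrArg Polynomial.derivative (binomialTail_eq_add (show k + 1 ≤ n by omega))
    rw [ih (by omega), Polynomial.derivative_add, bernsteinPolynomial.derivative_succ] at h1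
    linear_combination -h1

/-- Along `F' = a (1 - F)` this makes the tails `G k` satisfy `G (k + 1)' = a (n - k) (G k - G (k +
1))`, the equation produced by convolution with an exponential density of rate `a (n - k)`. -/
theorem one_sub_X_mul_derivative_binomialTail {n k : ℕ} (h : k < n) :
    (1 - Polynomial.X) * Polynomial.derivative (binomialTail n (k + 1)) =
      Polynomial.C ((n : ℝ) - k) * (binomialTail n k - binomialTail n (k + 1)) := by
  rw [binomialTail_eq_add h.le, add_sub_cancel_right, derivative_binomialTail_succ h,
    bernsteinPolynomial, bernsteinPolynomial]
  obtain ⟨d, rfl⟩ : ∃ d, n = k + d + 1 := ⟨n - k - 1, by omega⟩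
  rw [show k + d + 1 - 1 - k = d by omega, show k + d + 1 - k = d + 1 by omega,
    show k + d + 1 - 1 = k + d by omega]
  have h1 : ((k + d + 1 : ℕ) : ℝ) * ((k + d).choose k : ℝ) =
      (((k + d + 1 : ℕ) : ℝ) - k) * ((k + d + 1).choose k : ℝ) := by
    have := Nat.add_one_mul_choose_eq (k + d) d
    have e1 : (k + d).choose k = (k + d).choose d := by
      rw [← Nat.choose_symm_of_eq_add]; omega
    have e2 : (k + d + 1).choose k = (k + d + 1).choose (d + 1) := by
      rw [← Nat.choose_symm_of_eq_add]; omega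
    rw [e1, e2]
    have h3 : ((k + d + 1 : ℕ) : ℝ) * ((k + d).choose d : ℝ) =
      ((k + d + 1).choose (d + 1) : ℝ) * ((d + 1 : ℕ) : ℝ) := by exact_mod_cast this
    rw [h3]; push_cast; ring
  have h2 := congrArg Polynomial.C h1
  simp only [Polynomial.C_mul, Polynomial.C_eq_natCast] at h2
  linear_combination (1 - Polynomial.X) ^ (d + 1) * Polynomial.X ^ k * h2

theorem eq_of_derivative_eq_C_mul_add {r : ℝ} {A B G : ℝ⟦X⟧}
    (hA : d⁄dX ℝ A = C r * A + G) (hB : d⁄dX ℝ B = C r * B + G)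
    (h0 : constantCoeff A = constantCoeff B) : A = B := by
  ext q
  induction q with
  | zero => simpa using h0
  | succ q ih =>
    have h1 := congrArg (coeff q) hA
    have h2 := congrArg (coeff q) hB
    rw [coeff_derivative, map_add, coeff_C_mul] at h1 h2
    rw [ih, ← h2] at h1
    exact mul_right_cancel₀ (by positivity) h1

/-- The series of derivatives at `0` of `x ↦ a * exp (ρ x)`. -/
noncomputable def geomSeries (a ρ : ℝ) : ℝ⟦X⟧ := PowerSeries.mk fun q => a * ρ ^ q

theorem coeff_geomSeries (a ρ : ℝ) (q : ℕ) : coeff q (geomSeries a ρ) = a * ρ ^ q := by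
  simp [geomSeries]

theorem coeff_scaleDensity (c : ℝ) (Φ : ℝ⟦X⟧) (q : ℕ) :
    coeff q (scaleDensity c Φ) = c ^ (q + 1) * coeff q Φ := by
  rw [scaleDensity, coeff_C_mul, coeff_rescale]; ring

/-- The geometric series `c a / (1 - c ρ X)` with its denominator cleared. -/
theorem scaleDensity_geomSeries (c a ρ : ℝ) :
    scaleDensity c (geomSeries a ρ) =
      C (c * a) + C (c * ρ) * (X * scaleDensity c (geomSeries a ρ)) := by
  ext q
  rw [map_add, coeff_C_mul, coeff_scaleDensity, coeff_geomSeries, coeff_C]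
  cases q with
  | zero => simp
  | succ q =>
    rw [coeff_succ_X_mul, coeff_scaleDensity, coeff_geomSeries, if_neg (Nat.succ_ne_zero q)]
    ring

theorem derivative_borelTransform_mul_scaleDensity_geomSeries (c a ρ : ℝ) (G : ℝ⟦X⟧) :
    d⁄dX ℝ (borelTransform (G * (X * scaleDensity c (geomSeries a ρ)))) =
      C (c * ρ) * borelTransform (G * (X * scaleDensity c (geomSeries a ρ))) +
        C (c * a) * borelTransform G := by
  have h : G * (X * scaleDensity c (geomSeries a ρ)) = X *
      (C (c * ρ) * (G * (X * scaleDensity c (geomSeries a ρ))) + C (c * a) * G) := by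
    conv_lhs => rw [scaleDensity_geomSeries]
    ring
  conv_lhs => rw [h]
  rw [derivative_borelTransform_X_mul, borelTransform_add, borelTransform_C_mul,
    borelTransform_C_mul]

theorem constantCoeff_borelTransform_mul_X_mul (G A : ℝ⟦X⟧) :
    constantCoeff (borelTransform (G * (X * A))) = 0 := by
  rw [mul_left_comm, constantCoeff_borelTransform_X_mul]

theorem derivative_borelTransform_X_mul_geomSeries (a ρ : ℝ) :
    d⁄dX ℝ (borelTransform (X * geomSeries a ρ)) =
      C a + C ρ * borelTransform (X * geomSeries a ρ) := by
  have h : geomSeries a ρ = C a + C ρ * (X * geomSeries a ρ) := by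
    simpa [scaleDensity] using scaleDensity_geomSeries 1 a ρ
  rw [derivative_borelTransform_X_mul]
  conv_lhs => rw [h]
  rw [borelTransform_add, borelTransform_C_mul, ← mul_one (C a), borelTransform_C_mul,
    borelTransform_one]

/-- The formal Rényi representation for the exponential law of rate `a`. -/
theorem borelTransform_prod_scaleDensity_geomSeries (a : ℝ) {n k : ℕ} (hkn : k ≤ n) :
    borelTransform (∏ i ∈ Finset.range k, X * scaleDensity ((n : ℝ) - i) (geomSeries a (-a))) =
      Polynomial.aeval (borelTransform (X * geomSeries a (-a))) (binomialTail n k) := by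
  induction k with
  | zero => simp [binomialTail_zero, borelTransform_one]
  | succ k ih =>
    rw [Finset.prod_range_succ]
    refine eq_of_derivative_eq_C_mul_add
      (derivative_borelTransform_mul_scaleDensity_geomSeries _ _ _ _) ?_ ?_
    · rw [ih (by omega), Derivation.map_aeval, derivative_borelTransform_X_mul_geomSeries]
      have h := congrArg (Polynomial.aeval (borelTransform (X * geomSeries a (-a))))
        (one_sub_X_mul_derivative_binomialTail (show k < n by omega))
      simp only [map_mul, map_sub, map_one, Polynomial.aeval_X, Polynomial.aeval_C] at h
      simp only [smul_eq_mul, map_mul, map_sub, map_neg]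
      have h3 : algebraMap ℝ ℝ⟦X⟧ (n : ℝ) - algebraMap ℝ ℝ⟦X⟧ (k : ℝ) =
        C (n : ℝ) - C (k : ℝ) := rfl
      rw [h3] at h
      linear_combination C a * h
    · obtain ⟨W, hW, -⟩ := exists_binomialTail_eq_mul hkn
      rw [constantCoeff_borelTransform_mul_X_mul, hW]
      simp [constantCoeff_borelTransform_X_mul]

/-- For `k = n` the tail is `F ^ n`, and `F' = a + ρ F` alone gives the required equation for its
powers. Thus `ρ` is not tied to `a`, which is the extra freedom in this case. -/
theorem borelTransform_prod_scaleDensity_geomSeries_self (a ρ : ℝ) (n : ℕ) :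
    borelTransform (∏ i ∈ Finset.range n, X * scaleDensity ((n : ℝ) - i) (geomSeries a ρ)) =
      Polynomial.aeval (borelTransform (X * geomSeries a ρ)) (binomialTail n n) := by
  -- Reversing the factors makes the scales independent of `n`, so that induction on `n` applies.
  have h : ∏ i ∈ Finset.range n, X * scaleDensity ((n : ℝ) - i) (geomSeries a ρ) =
      ∏ i ∈ Finset.range n, X * scaleDensity ((i : ℝ) + 1) (geomSeries a ρ) := by
    rw [← Finset.prod_range_reflect]
    refine Finset.prod_congr rfl fun i hi => ?_
    have := Finset.mem_range.1 hi
    rw [Nat.sub_sub, Nat.cast_sub (by omega)]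
    push_cast
    ring_nf
  rw [h, binomialTail_self, map_pow, Polynomial.aeval_X]
  clear h
  induction n with
  | zero => simp [borelTransform_one]
  | succ n ih =>
    rw [Finset.prod_range_succ]
    refine eq_of_derivative_eq_C_mul_add
      (derivative_borelTransform_mul_scaleDensity_geomSeries _ _ _ _) ?_ ?_
    · rw [ih, derivative_pow, derivative_borelTransform_X_mul_geomSeries]
      simp only [map_mul, map_add, map_one, map_natCast, Nat.cast_add, Nat.cast_one,
        Nat.add_sub_cancel]
      ring
    · rw [constantCoeff_borelTransform_mul_X_mul]
      simp [constantCoeff_borelTransform_X_mul]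

theorem prod_X_mul_scaleDensity (c : ℕ → ℝ) (Φ : ℝ⟦X⟧) (k : ℕ) :
    ∏ i ∈ Finset.range k, X * scaleDensity (c i) Φ =
      X ^ k * (C (∏ i ∈ Finset.range k, c i) * ∏ i ∈ Finset.range k, rescale (c i) Φ) := by
  simp only [scaleDensity, Finset.prod_mul_distrib, Finset.prod_const, Finset.card_range, map_prod]

theorem prod_natCast_sub {n k : ℕ} (hkn : k ≤ n) :
    ∏ i ∈ Finset.range k, ((n : ℝ) - i) = n.descFactorial k := by
  rw [Nat.descFactorial_eq_prod_range]
  push_cast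
  refine Finset.prod_congr rfl fun i hi => ?_
  have := Finset.mem_range.1 hi
  rw [Nat.cast_sub (by omega)]

/-- The product rule at lowest order. The extra factor `b` on the left avoids the exponent `k - 1`.
-/
theorem coeff_prod_sub_prod {m : ℕ} (hm : 1 ≤ m) {b : ℝ} {A B : ℕ → ℝ⟦X⟧}
    (hdvd : ∀ i, X ^ m ∣ A i - B i) (hA : ∀ i, constantCoeff (A i) = b) (k : ℕ) :
    X ^ m ∣ ∏ i ∈ Finset.range k, A i - ∏ i ∈ Finset.range k, B i ∧
    coeff m (∏ i ∈ Finset.range k, A i - ∏ i ∈ Finset.range k, B i) * b =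
      (∑ i ∈ Finset.range k, coeff m (A i - B i)) * b ^ k := by
  induction k with
  | zero => simp
  | succ k ih =>
    have hB : ∀ i, constantCoeff (B i) = b := fun i => by
      have := (X_pow_dvd_iff.1 (hdvd i)) 0 (by omega)
      simp only [coeff_zero_eq_constantCoeff, map_sub, hA i] at this
      linarith
    obtain ⟨⟨D, hD⟩, h2⟩ := ih
    obtain ⟨δ, hδ⟩ := hdvd k
    have h : ∏ i ∈ Finset.range (k + 1), A i - ∏ i ∈ Finset.range (k + 1), B i =
        X ^ m * (δ * ∏ i ∈ Finset.range k, A i + B k * D) := by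
      rw [Finset.prod_range_succ, Finset.prod_range_succ]
      linear_combination (∏ i ∈ Finset.range k, A i) * hδ + B k * hD
    refine ⟨⟨_, h⟩, ?_⟩
    rw [h, Finset.sum_range_succ, hδ, coeff_X_pow_mul_self, coeff_X_pow_mul_self]
    rw [hD, coeff_X_pow_mul_self] at h2
    simp only [map_add, map_mul, map_prod, hA, hB, Finset.prod_const, Finset.card_range]
    linear_combination b * h2

theorem constantCoeff_aeval (P : Polynomial ℝ) (F : ℝ⟦X⟧) :
    constantCoeff (Polynomial.aeval F P) = P.eval (constantCoeff F) := by
  rw [Polynomial.aeval_def, Polynomial.hom_eval₂]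
  rfl

/-- The leading coefficients on both sides of the formal identity only match if the density does
not vanish at `0`. -/
theorem constantCoeff_ne_zero_of_borelTransform_prod_eq {n k : ℕ} (hn : 2 ≤ n) (hk : 1 ≤ k)
    (hkn : k ≤ n)
    {Φ : ℝ⟦X⟧} (hΦ : Φ ≠ 0)
    (h : borelTransform (∏ i ∈ Finset.range k, X * scaleDensity ((n : ℝ) - i) Φ) =
      Polynomial.aeval (borelTransform (X * Φ)) (binomialTail n k)) : constantCoeff Φ ≠ 0 := by
  obtain ⟨r, hr⟩ : ∃ r : ℕ, Φ.order = r :=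
    ⟨Φ.order.toNat, (ENat.natCast_toNat (by simpa using hΦ)).symm⟩
  obtain ⟨hr1, hr2⟩ := (order_eq_nat).1 hr
  obtain ⟨U, hU⟩ := X_pow_dvd_iff.2 hr2
  have hU0 : constantCoeff U = coeff r Φ := by rw [hU, coeff_X_pow_mul_self]
  rcases Nat.eq_zero_or_pos r with rfl | hrpos
  · simpa using hr1
  exfalso
  obtain ⟨V, hV⟩ : X ^ (r + 1) ∣ borelTransform (X * Φ) :=
    X_pow_dvd_borelTransform ⟨U, by rw [hU]; ring⟩
  have hV0 : constantCoeff V = coeff r Φ / (r + 1)! := by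
    rw [← coeff_X_pow_mul_self (r + 1) V, ← hV, coeff_borelTransform, coeff_succ_X_mul]
  obtain ⟨W, hW, hW0⟩ := exists_binomialTail_eq_mul hkn
  have hL : ∏ i ∈ Finset.range k, X * scaleDensity ((n : ℝ) - i) Φ =
      X ^ (k * (r + 1)) * ∏ i ∈ Finset.range k, (C (((n : ℝ) - i) ^ (r + 1)) *
        rescale ((n : ℝ) - i) U) := by
    rw [mul_comm k, pow_mul, ← Finset.card_range k, ← Finset.prod_const, Finset.card_range,
      ← Finset.prod_mul_distrib]
    refine Finset.prod_congr rfl fun i _ => ?_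
    rw [scaleDensity, hU, map_mul, map_pow, rescale_X, map_pow]
    ring
  have h1 := congrArg (coeff (k * (r + 1))) h
  rw [coeff_borelTransform, hL, coeff_X_pow_mul_self, hW, map_mul, map_pow,
    Polynomial.aeval_X] at h1
  conv_rhs at h1 => rw [hV]
  rw [mul_pow, ← pow_mul, mul_comm (r + 1) k, mul_assoc, coeff_X_pow_mul_self, map_mul, map_pow,
    hV0, constantCoeff_aeval, ← hV, constantCoeff_borelTransform_X_mul, hW0, map_prod] at h1
  have h2 : ∀ i : ℕ, constantCoeff (C (((n : ℝ) - i) ^ (r + 1)) * rescale ((n : ℝ) - i) U) =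
      ((n : ℝ) - i) ^ (r + 1) * coeff r Φ := fun i => by
    rw [map_mul, ← coeff_zero_eq_constantCoeff_apply (rescale _ _), coeff_rescale]
    simp [hU0]
  simp only [h2, Finset.prod_mul_distrib, Finset.prod_const, Finset.card_range,
    Finset.prod_pow, prod_natCast_sub hkn, div_pow] at h1
  have h3 : (n.descFactorial k : ℝ) ^ (r + 1) * (r + 1)! ^ k = n.choose k * (k * (r + 1))! := by
    have : (coeff r Φ) ^ k ≠ 0 := pow_ne_zero _ hr1
    have : ((k * (r + 1))! : ℝ) ≠ 0 := by positivity
    have : (((r + 1)! : ℕ) : ℝ) ^ k ≠ 0 := by positivity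
    field_simp at h1
    linear_combination h1
  have h4 : n.descFactorial k ^ (r + 1) * (r + 1)! ^ k = n.choose k * (k * (r + 1))! := by
    exact_mod_cast h3
  -- One of the `r + 1` descending factorials equals `k ! * n.choose k`; cancelling the binomial
  -- coefficient leaves the exponent `r`.
  refine descFactorial_pow_mul_ne_factorial hn hk hkn hrpos ?_
  refine Nat.eq_of_mul_eq_mul_left (Nat.choose_pos hkn) ?_
  rw [← h4, pow_succ]
  conv_rhs => rw [Nat.descFactorial_eq_factorial_mul_choose n k]
  conv_lhs => rw [Nat.descFactorial_eq_factorial_mul_choose n k]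
  ring

/-- Two solutions of the formal identity with the same value at `0` (and the same first derivative
if `k = n`) agree. -/
theorem eq_of_borelTransform_prod_eq {n k : ℕ} (hn : 2 ≤ n) (hk : 1 ≤ k) (hkn : k ≤ n) {Φ Ψ : ℝ⟦X⟧}
    (hΦ : borelTransform (∏ i ∈ Finset.range k, X * scaleDensity ((n : ℝ) - i) Φ) =
      Polynomial.aeval (borelTransform (X * Φ)) (binomialTail n k))
    (hΨ : borelTransform (∏ i ∈ Finset.range k, X * scaleDensity ((n : ℝ) - i) Ψ) =
      Polynomial.aeval (borelTransform (X * Ψ)) (binomialTail n k))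
    (h0 : constantCoeff Φ ≠ 0) (h00 : constantCoeff Ψ = constantCoeff Φ)
    (h1 : k = n → coeff 1 Ψ = coeff 1 Φ) : Φ = Ψ := by
  by_contra hne
  have hD : Φ - Ψ ≠ 0 := sub_ne_zero.2 hne
  obtain ⟨m, hm⟩ : ∃ m : ℕ, (Φ - Ψ).order = m :=
    ⟨(Φ - Ψ).order.toNat, (ENat.natCast_toNat (by simpa using hD)).symm⟩
  obtain ⟨hm1, hm2⟩ := (order_eq_nat).1 hm
  have hdvd : X ^ m ∣ Φ - Ψ := X_pow_dvd_iff.2 hm2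
  have hm0 : 1 ≤ m := by
    by_contra hc
    obtain rfl : m = 0 := by omega
    simp [h00] at hm1
  have hmk : k < n ∨ 2 ≤ m := by
    rcases hkn.lt_or_eq with h | h
    · exact Or.inl h
    · right
      by_contra hc
      obtain rfl : m = 1 := by omega
      simp [h1 h] at hm1
  set b := constantCoeff Φ with hb
  set d := coeff m (Φ - Ψ) with hd
  have hres : ∀ i : ℕ, X ^ m ∣ rescale ((n : ℝ) - i) Φ - rescale ((n : ℝ) - i) Ψ := fun i => by
    rw [X_pow_dvd_iff]
    intro q hq
    rw [← map_sub, coeff_rescale, hm2 q hq, mul_zero]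
  have hres0 : ∀ i : ℕ, constantCoeff (rescale ((n : ℝ) - i) Φ) = b := fun i => by
    rw [← coeff_zero_eq_constantCoeff_apply, coeff_rescale]; simp [hb]
  obtain ⟨-, hL⟩ := coeff_prod_sub_prod hm0 hres hres0 k
  have hLs : ∑ i ∈ Finset.range k, coeff m (rescale ((n : ℝ) - i) Φ - rescale ((n : ℝ) - i) Ψ) =
      (∑ i ∈ Finset.range k, (n - i) ^ m : ℕ) * d := by
    push_cast
    rw [Finset.sum_mul]
    refine Finset.sum_congr rfl fun i hi => ?_
    have := Finset.mem_range.1 hi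
    rw [← map_sub, coeff_rescale, Nat.cast_sub (by omega)]
  obtain ⟨F, hF⟩ : X ∣ borelTransform (X * Φ) := by
    simpa using X_pow_dvd_borelTransform (m := 1) (A := X * Φ) (by simp)
  obtain ⟨E, hE⟩ : X ∣ borelTransform (X * Ψ) := by
    simpa using X_pow_dvd_borelTransform (m := 1) (A := X * Ψ) (by simp)
  have hFc : ∀ q, coeff q F = coeff q Φ / (q + 1)! := fun q => by
    rw [← coeff_succ_X_mul, ← hF, coeff_borelTransform, coeff_succ_X_mul]
  have hEc : ∀ q, coeff q E = coeff q Ψ / (q + 1)! := fun q => by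
    rw [← coeff_succ_X_mul, ← hE, coeff_borelTransform, coeff_succ_X_mul]
  have hFE : ∀ q, coeff q (F - E) = coeff q (Φ - Ψ) / (q + 1)! := fun q => by
    rw [map_sub, hFc, hEc, map_sub, sub_div]
  have hFEd : X ^ m ∣ F - E := X_pow_dvd_iff.2 fun q hq => by rw [hFE, hm2 q hq, zero_div]
  have hF0 : constantCoeff F = b := by
    rw [← coeff_zero_eq_constantCoeff_apply, hFc]; simp [hb]
  obtain ⟨⟨T, hT⟩, hR⟩ := coeff_prod_sub_prod (A := fun _ => F) (B := fun _ => E) hm0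
    (fun _ => hFEd) (fun _ => hF0) k
  simp only [Finset.prod_const, Finset.card_range, Finset.sum_const, nsmul_eq_mul, hFE] at hT hR
  rw [hT, coeff_X_pow_mul_self] at hR
  obtain ⟨W, hW, hW0⟩ := exists_binomialTail_eq_mul hkn
  -- The cofactor `W` varies only from degree `m + 1` on, so in degree `k + m` only the variation of
  -- the `k`-th power counts.
  obtain ⟨S, hS⟩ : X ^ (m + 1) ∣
      Polynomial.aeval (borelTransform (X * Φ)) W -
      Polynomial.aeval (borelTransform (X * Ψ)) W := by
    have h2 : X ^ (m + 1) ∣ borelTransform (X * Φ) - borelTransform (X * Ψ) := by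
      rw [hF, hE, ← mul_sub, pow_succ']
      exact mul_dvd_mul_left _ hFEd
    refine h2.trans ?_
    rw [Polynomial.aeval_def, Polynomial.aeval_def, ← Polynomial.eval_map, ← Polynomial.eval_map]
    exact Polynomial.sub_dvd_eval_sub _ _ _
  have hdiff := congrArg (coeff (k + m)) (congrArg₂ (· - ·) hΦ hΨ)
  have hRd : Polynomial.aeval (borelTransform (X * Φ)) (binomialTail n k) -
      Polynomial.aeval (borelTransform (X * Ψ)) (binomialTail n k) =
      X ^ (k + m) * (T * Polynomial.aeval (borelTransform (X * Φ)) W + X * (E ^ k * S)) := by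
    rw [hW, map_mul, map_mul, map_pow, map_pow, Polynomial.aeval_X, Polynomial.aeval_X]
    have e1 : borelTransform (X * Φ) ^ k = X ^ k * F ^ k := by rw [hF, mul_pow]
    have e2 : borelTransform (X * Ψ) ^ k = X ^ k * E ^ k := by rw [hE, mul_pow]
    rw [e1, e2, pow_add]
    rw [pow_succ] at hS
    linear_combination X ^ k * Polynomial.aeval (borelTransform (X * Φ)) W * hT + X ^ k * E ^ k * hS
  rw [hRd, coeff_X_pow_mul_self, ← borelTransform_sub, coeff_borelTransform,
    prod_X_mul_scaleDensity,
    prod_X_mul_scaleDensity, ← mul_sub, ← mul_sub, add_comm k m, coeff_X_pow_mul, coeff_C_mul,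
    prod_natCast_sub hkn, map_add, map_mul, constantCoeff_aeval, constantCoeff_borelTransform_X_mul,
    hW0, map_mul, constantCoeff_X, zero_mul, add_zero] at hdiff
  rw [hLs] at hL
  have hfin : (n.descFactorial k : ℝ) * (∑ i ∈ Finset.range k, (n - i) ^ m : ℕ) * (m + 1)! =
      n.choose k * k * (m + k)! := by
    have hbk : b ^ k ≠ 0 := pow_ne_zero _ h0
    have f1 : ((m + k)! : ℝ) ≠ 0 := by positivity
    have f2 : (((m + 1)! : ℕ) : ℝ) ≠ 0 := by positivity
    have hd0 : d ≠ 0 := hm1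
    rw [← hd] at hR
    refine mul_right_cancel₀ (mul_ne_zero hd0 hbk) ?_
    rw [div_eq_iff f1] at hdiff
    have hR' : constantCoeff T * b * (m + 1)! = k * d * b ^ k := by
      rw [hR]; field_simp
    linear_combination (-(n.descFactorial k : ℝ) * (m + 1)!) * hL + b * (m + 1)! * hdiff +
      n.choose k * (m + k)! * hR'
  have hfin' : n.descFactorial k * (∑ i ∈ Finset.range k, (n - i) ^ m) * (m + 1)! =
      n.choose k * k * (m + k)! := by exact_mod_cast hfin
  have hlt := choose_lt_sum_pow hn hk hkn hm0 hmk
  have hch : (m + k).choose (m + 1) * (m + 1)! * (k - 1)! = (m + k)! := by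
    have := Nat.choose_mul_factorial_mul_factorial (show m + 1 ≤ m + k by omega)
    rwa [show m + k - (m + 1) = k - 1 by omega] at this
  rw [Nat.descFactorial_eq_factorial_mul_choose, ← hch, ← Nat.mul_factorial_pred (by omega : k ≠ 0)]
    at hfin'
  have hpos : 0 < k * (k - 1)! * n.choose k * (m + 1)! := by
    have := Nat.choose_pos hkn
    positivity
  -- The coefficient equation in degree `k + m` with all common factors removed; it contradicts
  -- `hlt`.
  have : (∑ i ∈ Finset.range k, (n - i) ^ m) = (m + k).choose (m + 1) := by
    refine Nat.eq_of_mul_eq_mul_left hpos ?_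
    linear_combination hfin'
  omega

theorem exists_eq_geomSeries_of_borelTransform_prod_eq {n k : ℕ} (hn : 2 ≤ n) (hk : 1 ≤ k)
    (hkn : k ≤ n)
    {Φ : ℝ⟦X⟧} (hΦ : Φ ≠ 0)
    (h : borelTransform (∏ i ∈ Finset.range k, X * scaleDensity ((n : ℝ) - i) Φ) =
      Polynomial.aeval (borelTransform (X * Φ)) (binomialTail n k)) :
    ∃ a ρ : ℝ, a ≠ 0 ∧ Φ = geomSeries a ρ := by
  have h0 := constantCoeff_ne_zero_of_borelTransform_prod_eq hn hk hkn hΦ h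
  have hc : ∀ ρ, constantCoeff (geomSeries (constantCoeff Φ) ρ) = constantCoeff Φ := fun ρ => by
    rw [← coeff_zero_eq_constantCoeff_apply, coeff_geomSeries]; simp
  rcases hkn.lt_or_eq with hlt | rfl
  · exact ⟨constantCoeff Φ, -constantCoeff Φ, h0, eq_of_borelTransform_prod_eq hn hk hkn h
      (borelTransform_prod_scaleDensity_geomSeries _ hkn) h0 (hc _) (fun e => absurd e hlt.ne)⟩
  -- The ratio is chosen to match the first derivative as well.
  · refine ⟨constantCoeff Φ, coeff 1 Φ / constantCoeff Φ, h0,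
      eq_of_borelTransform_prod_eq hn hk hkn h
      (borelTransform_prod_scaleDensity_geomSeries_self _ _ _) h0 (hc _) fun _ => ?_⟩
    rw [coeff_geomSeries]
    field_simp

end FormalSeries

/-! ### Power series expansions on the positive half-line. -/

open PowerSeries in
/-- The function `g` is the sum of the power series `A` at every positive real. -/
def HasMaclaurinSeries (g : ℝ → ℝ) (A : ℝ⟦X⟧) : Prop :=
  ∀ x, 0 < x → HasSum (fun q => coeff q A * x ^ q) (g x)

theorem integral_sub_pow_mul_pow (x : ℝ) (i j : ℕ) :
    ∫ y in (0 : ℝ)..x, (x - y) ^ i * y ^ j = i ! * j ! / (i + j + 1)! * x ^ (i + j + 1) := by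
  induction i generalizing j with
  | zero =>
    simp only [pow_zero, one_mul, integral_pow, zero_add, Nat.factorial_succ, Nat.factorial_zero]
    have : (j ! : ℝ) ≠ 0 := by positivity
    push_cast
    field_simp
    simp
  | succ i ih =>
    have hu : ∀ y ∈ Set.uIcc 0 x, HasDerivAt (fun y : ℝ => (x - y) ^ (i + 1))
        (-((i + 1 : ℝ) * (x - y) ^ i)) y := fun y _ => by
      simpa using! ((hasDerivAt_id y).const_sub x).pow (i + 1)
    have hv : ∀ y ∈ Set.uIcc 0 x, HasDerivAt (fun y : ℝ => y ^ (j + 1) / (j + 1 : ℝ))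
        (y ^ j) y := fun y _ => by
      have h1 := (hasDerivAt_pow (j + 1) y).div_const (j + 1 : ℝ)
      rwa [Nat.cast_succ, Nat.add_sub_cancel, mul_div_cancel_left₀ _ (by positivity)] at h1
    rw [intervalIntegral.integral_mul_deriv_eq_deriv_mul hu hv
      (Continuous.intervalIntegrable (by fun_prop) _ _)
      (Continuous.intervalIntegrable (by fun_prop) _ _)]
    have h2 : ∀ y : ℝ, -((i + 1 : ℝ) * (x - y) ^ i) * (y ^ (j + 1) / (j + 1 : ℝ)) =
        -((i + 1 : ℝ) / (j + 1)) * ((x - y) ^ i * y ^ (j + 1)) := fun y => by ring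
    simp only [h2, intervalIntegral.integral_const_mul, ih]
    rw [show i + (j + 1) + 1 = i + 1 + j + 1 by ring, Nat.factorial_succ i, Nat.factorial_succ j]
    have : (j + 1 : ℝ) ≠ 0 := by positivity
    have : ((i + 1 + j + 1)! : ℝ) ≠ 0 := by positivity
    push_cast
    field_simp
    simp

namespace HasMaclaurinSeries

open PowerSeries

variable {g h : ℝ → ℝ} {A B : ℝ⟦X⟧}

theorem congr (hg : HasMaclaurinSeries g A) (hgh : ∀ x, 0 < x → h x = g x) :
    HasMaclaurinSeries h A := fun x hx => (hgh x hx).symm ▸ hg x hx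

theorem summable_norm (hg : HasMaclaurinSeries g A) {x : ℝ} (hx : 0 < x) :
    Summable fun q => ‖coeff q A * x ^ q‖ := (hg x hx).summable.norm

theorem const (r : ℝ) : HasMaclaurinSeries (fun _ => r) (C r) := fun x _ => by
  have h : (fun q => coeff q (C r : ℝ⟦X⟧) * x ^ q) = fun q => if q = 0 then r else 0 := by
    ext q; rw [coeff_C]; split_ifs with h <;> simp [h]
  rw [h]
  exact hasSum_ite_eq 0 r

theorem add (hg : HasMaclaurinSeries g A) (hh : HasMaclaurinSeries h B) :
    HasMaclaurinSeries (fun x => g x + h x) (A + B) := fun x hx => by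
  simpa [add_mul] using (hg x hx).add (hh x hx)

theorem mul (hg : HasMaclaurinSeries g A) (hh : HasMaclaurinSeries h B) :
    HasMaclaurinSeries (fun x => g x * h x) (A * B) := fun x hx => by
  have hs := summable_norm_sum_mul_antidiagonal_of_summable_norm
    (hg.summable_norm hx) (hh.summable_norm hx)
  have ht := tsum_mul_tsum_eq_tsum_sum_antidiagonal_of_summable_norm
    (hg.summable_norm hx) (hh.summable_norm hx)
  rw [(hg x hx).tsum_eq, (hh x hx).tsum_eq] at ht
  simp only [ht]
  refine HasSum.congr_fun hs.of_norm.hasSum fun q => ?_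
  rw [coeff_mul, Finset.sum_mul]
  refine Finset.sum_congr rfl fun p hp => ?_
  rw [← Finset.HasAntidiagonal.mem_antidiagonal.1 hp]
  ring

theorem aeval (hg : HasMaclaurinSeries g A) (P : Polynomial ℝ) :
    HasMaclaurinSeries (fun x => P.eval (g x)) (Polynomial.aeval A P) := by
  induction P using Polynomial.induction_on' with
  | add p q hp hq => simpa using hp.add hq
  | monomial n r =>
    simp only [Polynomial.eval_monomial, Polynomial.aeval_monomial]
    refine (const r).mul ?_
    induction n with
    | zero => simpa using const 1
    | succ n ih => simpa only [pow_succ] using ih.mul hg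

theorem scale {c : ℝ} (hc : 0 < c) (hg : HasMaclaurinSeries g (borelTransform A)) :
    HasMaclaurinSeries (fun x => c * g (c * x)) (borelTransform (scaleDensity c A)) :=
      fun x hx => by
  refine HasSum.congr_fun ((hg (c * x) (by positivity)).mul_left c) fun q => ?_
  rw [coeff_borelTransform, coeff_scaleDensity, coeff_borelTransform]
  ring

/-- Dividing the difference by its leading power leaves a series summing to `0` whose constant term
is at most `x * M` for `0 < x ≤ 1`. Letting `x` be small makes that term vanish. -/
theorem unique (hA : HasMaclaurinSeries g A) (hB : HasMaclaurinSeries g B) : A = B := by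
  have hD : HasMaclaurinSeries (fun _ => 0) (A - B) := fun x hx => by
    simpa [sub_mul] using (hA x hx).sub (hB x hx)
  rw [← sub_eq_zero]
  by_contra hne
  obtain ⟨r, hr⟩ : ∃ r : ℕ, (A - B).order = r :=
    ⟨(A - B).order.toNat, (ENat.natCast_toNat (by simpa using hne)).symm⟩
  obtain ⟨hr1, hr2⟩ := order_eq_nat.1 hr
  obtain ⟨U, hU⟩ := X_pow_dvd_iff.2 hr2
  have hU0 : constantCoeff U = coeff r (A - B) := by rw [hU, coeff_X_pow_mul_self]
  have hUs : HasMaclaurinSeries (fun _ => 0) U := fun x hx => by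
    have h1 := (hasSum_nat_add_iff' r).2 (hD x hx)
    rw [Finset.sum_eq_zero fun i hi => by rw [hr2 i (Finset.mem_range.1 hi), zero_mul],
      sub_zero] at h1
    have h2 := h1.mul_right (x ^ r)⁻¹
    rw [zero_mul] at h2
    refine HasSum.congr_fun h2 fun q => ?_
    rw [hU, coeff_X_pow_mul, pow_add]
    field_simp
  set M := ∑' q, ‖coeff (q + 1) U‖
  have hsum : Summable fun q => ‖coeff (q + 1) U‖ := by
    have := (summable_nat_add_iff 1).2 (hUs.summable_norm one_pos)
    simpa using this
  have hbound : ∀ x : ℝ, 0 < x → x ≤ 1 → ‖constantCoeff U‖ ≤ x * M := fun x hx hx1 => by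
    have h1 := (hasSum_nat_add_iff' 1).2 (hUs x hx)
    simp only [Finset.sum_range_one, pow_zero, mul_one, zero_sub, coeff_zero_eq_constantCoeff] at h1
    rw [← norm_neg, ← tsum_mul_left]
    refine h1.norm_le_of_bounded (hsum.mul_left x).hasSum fun q => ?_
    rw [norm_mul, norm_pow, Real.norm_of_nonneg hx.le, mul_comm x]
    refine mul_le_mul_of_nonneg_left ?_ (norm_nonneg _)
    calc x ^ (q + 1) = x ^ q * x := pow_succ _ _
      _ ≤ 1 * x := by gcongr; exact pow_le_one₀ hx.le hx1
      _ = x := one_mul x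
  have hM : 0 ≤ M := tsum_nonneg fun _ => norm_nonneg _
  have hpos : 0 < ‖constantCoeff U‖ := norm_pos_iff.2 (hU0 ▸ hr1)
  set t := ‖constantCoeff U‖
  have h2 := hbound (min 1 (t / (2 * (M + 1)))) (lt_min one_pos (by positivity)) (min_le_left _ _)
  have h3 : min 1 (t / (2 * (M + 1))) * M ≤ t / (2 * (M + 1)) * (M + 1) :=
    mul_le_mul (min_le_right _ _) (by linarith) hM (by positivity)
  have h4 : t / (2 * (M + 1)) * (M + 1) = t / 2 := by field_simp
  linarith

/-- Convolution on the positive half-line multiplies the series of derivatives at `0`. -/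
theorem convolution (hg : HasMaclaurinSeries g (borelTransform A))
    (hh : HasMaclaurinSeries h (borelTransform B)) :
    HasMaclaurinSeries (fun x => ∫ y in Set.Ioo 0 x, g (x - y) * h y)
      (borelTransform (A * (X * B))) := fun x hx => by
  set α := fun i => coeff i (borelTransform A) with hα
  set β := fun j => coeff j (borelTransform B) with hβ
  have hint : ∀ p : ℕ × ℕ, ∫ y in Set.Ioo 0 x, (x - y) ^ p.1 * y ^ p.2 =
      p.1 ! * p.2 ! / (p.1 + p.2 + 1)! * x ^ (p.1 + p.2 + 1) := fun p => by
    rw [← integral_sub_pow_mul_pow, intervalIntegral.integral_of_le hx.le,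
      integral_Ioc_eq_integral_Ioo]
  let T : ℕ × ℕ → ℝ → ℝ := fun p y => (α p.1 * (x - y) ^ p.1) * (β p.2 * y ^ p.2)
  have hT : ∀ p, Integrable (T p) (volume.restrict (Set.Ioo 0 x)) := fun p =>
    ((Continuous.integrableOn_Icc (a := 0) (b := x) (by fun_prop)).mono_set Set.Ioo_subset_Icc_self)
  have hnorm : ∀ p, ∫ y in Set.Ioo 0 x, ‖T p y‖ =
      ‖α p.1‖ * ‖β p.2‖ * (p.1 ! * p.2 ! / (p.1 + p.2 + 1)! * x ^ (p.1 + p.2 + 1)) := fun p => by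
    rw [← hint, ← integral_const_mul]
    refine setIntegral_congr_fun measurableSet_Ioo fun y hy => ?_
    simp only [T, norm_mul, norm_pow]
    rw [Real.norm_of_nonneg hy.1.le, Real.norm_of_nonneg (sub_nonneg.2 hy.2.le)]
    ring
  have hsummable : Summable fun p => ∫ y in Set.Ioo 0 x, ‖T p y‖ := by
    have h1 := ((hg.summable_norm hx).mul_of_nonneg (hh.summable_norm hx)
      (fun _ => norm_nonneg _) (fun _ => norm_nonneg _)).mul_right x
    refine h1.of_nonneg_of_le (fun p => integral_nonneg fun _ => norm_nonneg _) fun p => ?_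
    rw [hnorm]
    -- This bounds the Beta integrals by the terms of an absolutely convergent double series, which
    -- justifies integrating term by term.
    have h2 : (p.1 ! * p.2 ! / (p.1 + p.2 + 1)! : ℝ) ≤ 1 := by
      rw [div_le_one (by positivity)]
      exact_mod_cast (Nat.factorial_mul_factorial_dvd_factorial_add p.1 p.2 |> Nat.le_of_dvd
        (Nat.factorial_pos _)).trans (Nat.factorial_le (Nat.le_succ _))
    simp only [norm_mul, norm_pow, Real.norm_of_nonneg hx.le]
    calc _ ≤ ‖α p.1‖ * ‖β p.2‖ * (1 * x ^ (p.1 + p.2 + 1)) := by gcongr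
      _ = _ := by simp only [hα, hβ]; ring
  have hS := hasSum_integral_of_summable_integral_norm hT hsummable
  have heq : ∫ y in Set.Ioo 0 x, ∑' p, T p y = ∫ y in Set.Ioo 0 x, g (x - y) * h y := by
    refine setIntegral_congr_fun measurableSet_Ioo fun y hy => ?_
    have hxy : 0 < x - y := sub_pos.2 hy.2
    exact ((hg _ hxy).mul (hh y hy.1) (summable_mul_of_summable_norm (hg.summable_norm hxy)
      (hh.summable_norm hy.1))).tsum_eq
  rw [heq] at hS
  have hTint : ∀ p, ∫ y in Set.Ioo 0 x, T p y =
      coeff p.1 A * coeff p.2 B / (p.1 + p.2 + 1)! * x ^ (p.1 + p.2 + 1) := fun p => by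
    have h1 : ∀ y, T p y = α p.1 * β p.2 * ((x - y) ^ p.1 * y ^ p.2) := fun y => by
      simp only [T]; ring
    simp only [h1]
    rw [integral_const_mul, hint]
    simp only [hα, hβ, coeff_borelTransform]
    have : (p.1 ! : ℝ) ≠ 0 := by positivity
    have : (p.2 ! : ℝ) ≠ 0 := by positivity
    field_simp
  have hS2 := ((Finset.HasAntidiagonal.sigmaAntidiagonalEquivProd (A := ℕ)).hasSum_iff.2 hS).sigma
    fun q => hasSum_fintype _
  rw [← hasSum_nat_add_iff' 1]
  have hzero : coeff 0 (borelTransform (A * (X * B))) = 0 := by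
    rw [coeff_borelTransform]; simp
  simp only [Finset.sum_range_one, hzero, zero_mul, sub_zero]
  refine HasSum.congr_fun hS2 fun q => ?_
  simp only [Function.comp, Finset.HasAntidiagonal.sigmaAntidiagonalEquivProd_apply, hTint]
  rw [Finset.univ_eq_attach, Finset.sum_attach (Finset.HasAntidiagonal.antidiagonal q)
    (fun p => coeff p.1 A * coeff p.2 B / (p.1 + p.2 + 1)! * x ^ (p.1 + p.2 + 1)),
    mul_left_comm, coeff_borelTransform, coeff_succ_X_mul, coeff_mul, Finset.sum_div,
    Finset.sum_mul]
  refine Finset.sum_congr rfl fun p hp => ?_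
  rw [Finset.HasAntidiagonal.mem_antidiagonal.1 hp]

end HasMaclaurinSeries

/-! ### The distribution function of an order statistic. -/

section OrderStatistic

variable {n : ℕ}

theorem orderStatistic_le_iff (x : Fin n → ℝ) (i : Fin n) (t : ℝ) :
    orderStatistic x i ≤ t ↔ (i : ℕ) < (Finset.univ.filter fun j => x j ≤ t).card := by
  rw [orderStatistic, ← Function.comp_apply (f := x),
    ← Tuple.lt_card_le_iff_apply_le_of_monotone (Tuple.monotone_sort x)]
  have h : (Finset.univ.filter fun j => x j ≤ t).card =
      (Finset.univ.filter fun j => (x ∘ Tuple.sort x) j ≤ t).card := by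
    rw [← Finset.card_map (Tuple.sort x).symm.toEmbedding]
    congr 1
    ext j
    simp
  rw [h]

/-- The samples whose entries at most `t` are exactly those with index in `A`. -/
def lowerPattern (t : ℝ) (A : Finset (Fin n)) : Set (Fin n → ℝ) :=
  Set.univ.pi fun i => if i ∈ A then Set.Iic t else Set.Ioi t

theorem mem_lowerPattern_iff {t : ℝ} {A : Finset (Fin n)} {x : Fin n → ℝ} :
    x ∈ lowerPattern t A ↔ (Finset.univ.filter fun j => x j ≤ t) = A := by
  rw [lowerPattern, Set.mem_univ_pi, Finset.ext_iff]
  refine forall_congr' fun i => ?_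
  by_cases h : i ∈ A <;> simp [h]

theorem measurableSet_lowerPattern (t : ℝ) (A : Finset (Fin n)) :
    MeasurableSet (lowerPattern t A) := by
  refine MeasurableSet.univ_pi fun i => ?_
  split_ifs
  exacts [measurableSet_Iic, measurableSet_Ioi]

/-- Splitting by the set of indices whose entries are at most `t` gives a disjoint union of boxes,
used both for measurability and for the probability. -/
theorem setOf_orderStatistic_le (i : Fin n) (t : ℝ) :
    {x : Fin n → ℝ | orderStatistic x i ≤ t} =
      ⋃ A ∈ Finset.univ.filter (fun A : Finset (Fin n) => (i : ℕ) < A.card), lowerPattern t A := by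
  ext x
  simp [orderStatistic_le_iff, mem_lowerPattern_iff]

theorem measurable_orderStatistic (i : Fin n) :
    Measurable fun x : Fin n → ℝ => orderStatistic x i := by
  refine measurable_of_Iic fun t => ?_
  change MeasurableSet {x : Fin n → ℝ | orderStatistic x i ≤ t}
  rw [setOf_orderStatistic_le]
  exact Finset.measurableSet_biUnion _ fun A _ => measurableSet_lowerPattern t A

theorem pi_real_lowerPattern (μ : Measure ℝ) [IsProbabilityMeasure μ] (t : ℝ)
    (A : Finset (Fin n)) :
    (Measure.pi fun _ : Fin n => μ).real (lowerPattern t A) =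
      cdf μ t ^ A.card * (1 - cdf μ t) ^ (n - A.card) := by
  have h : ∀ i : Fin n, (μ (if i ∈ A then Set.Iic t else Set.Ioi t)).toReal =
      if i ∈ A then cdf μ t else 1 - cdf μ t := fun i => by
    split_ifs
    · rw [cdf_eq_real]; rfl
    · rw [← Set.compl_Iic, cdf_eq_real, ← probReal_compl_eq_one_sub measurableSet_Iic]; rfl
  rw [lowerPattern, measureReal_def, Measure.pi_pi, ENNReal.toReal_prod]
  simp only [h]
  rw [Finset.prod_ite]
  simp [Finset.filter_not, Finset.card_sdiff]

theorem pi_real_orderStatistic_le (μ : Measure ℝ) [IsProbabilityMeasure μ] (i : Fin n) (t : ℝ) :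
    (Measure.pi fun _ : Fin n => μ).real {x | orderStatistic x i ≤ t} =
      (binomialTail n (i + 1)).eval (cdf μ t) := by
  rw [setOf_orderStatistic_le, measureReal_biUnion_finset]
  · simp only [pi_real_lowerPattern]
    rw [Finset.sum_filter, ← Finset.powerset_univ,
      Finset.sum_powerset_apply_card
        (fun j => if (i : ℕ) < j then cdf μ t ^ j * (1 - cdf μ t) ^ (n - j) else 0),
      binomialTail, Polynomial.eval_finsetSum, Finset.card_univ, Fintype.card_fin]
    simp only [smul_ite, smul_zero]
    rw [← Finset.sum_filter]
    refine Finset.sum_congr (by ext j; simp; omega) fun j _ => ?_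
    simp [bernsteinPolynomial, mul_assoc]
  · intro A _ B _ hAB
    refine Set.disjoint_left.2 fun x hA hB => hAB ?_
    rw [← mem_lowerPattern_iff.1 hA, ← mem_lowerPattern_iff.1 hB]
  · exact fun A _ => measurableSet_lowerPattern t A

theorem cdf_map_orderStatistic {Ω : Type*} [MeasurableSpace Ω] {P : Measure Ω}
    [IsProbabilityMeasure P] {μ : Measure ℝ} [IsProbabilityMeasure μ] {X : Fin n → Ω → ℝ}
    (hlaw : ∀ i, HasLaw (X i) μ P) (hindep : iIndepFun X P) (i : Fin n) (t : ℝ) :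
    cdf (P.map fun ω => orderStatistic (fun j => X j ω) i) t =
      (binomialTail n (i + 1)).eval (cdf μ t) := by
  have hX : ∀ j, AEMeasurable (X j) P := fun j => (hlaw j).aemeasurable
  have hpi : P.map (fun ω j => X j ω) = Measure.pi fun _ : Fin n => μ := by
    rw [(iIndepFun_iff_map_fun_eq_pi_map hX).1 hindep]
    simp only [(hlaw _).map_eq]
  have hmap : P.map (fun ω => orderStatistic (fun j => X j ω) i) =
      (Measure.pi fun _ : Fin n => μ).map fun x => orderStatistic x i := by
    rw [← hpi, AEMeasurable.map_map_of_aemeasurable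
      (measurable_orderStatistic i).aemeasurable (aemeasurable_pi_lambda _ hX)]
    rfl
  have := Measure.isProbabilityMeasure_map
    (μ := Measure.pi fun _ : Fin n => μ) (measurable_orderStatistic i).aemeasurable
  rw [hmap, cdf_eq_real, map_measureReal_apply (measurable_orderStatistic i) measurableSet_Iic]
  exact pi_real_orderStatistic_le μ i t

end OrderStatistic

/-! ### Laws with a Maclaurin density, their scaled sums, and the exponential law. -/

section Density

open PowerSeries

/-- A probability law on the positive half-line with density `f`, the derivatives of `f` at `0`
being the coefficients of `Φ`. -/
structure IsPositiveDensity (μ : Measure ℝ) (f : ℝ → ℝ) (Φ : ℝ⟦X⟧) : Prop where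
  measurable : Measurable f
  nonneg : ∀ x, 0 ≤ f x
  eq_zero : ∀ x ≤ 0, f x = 0
  eq_withDensity : μ = volume.withDensity fun x => ENNReal.ofReal (f x)
  hasMaclaurinSeries : HasMaclaurinSeries f (borelTransform Φ)

/-- Since `F 0 = 0`, cutting the density off outside the positive half-line does not change the law.
The factor `q !` in `Φ` undoes the Borel transform. -/
theorem HasMaclaurinDensity.exists_isPositiveDensity {μ : Measure ℝ} [IsProbabilityMeasure μ]
    (hμ : HasMaclaurinDensity μ) : ∃ f Φ, IsPositiveDensity μ f Φ := by
  obtain ⟨f, hf, hf0, hμf, a, ha⟩ := hμ.density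
  refine ⟨(Set.Ioi 0).indicator f, PowerSeries.mk fun q => q ! * a q,
    hf.indicator measurableSet_Ioi, fun x => Set.indicator_nonneg (fun x _ => hf0 x) x,
    fun x hx => Set.indicator_of_notMem (by simpa using hx) f, ?_, fun x hx => ?_⟩
  · have h0 : μ (Set.Ioi 0)ᶜ = 0 := by
      rw [Set.compl_Ioi, ← ofReal_cdf, hμ.cdf_zero, ENNReal.ofReal_zero]
    have h1 : μ.restrict (Set.Ioi 0) = μ :=
      Measure.restrict_eq_self_of_ae_mem (by rw [ae_iff]; exact h0)
    have h2 : (fun x => ENNReal.ofReal ((Set.Ioi 0).indicator f x)) =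
        (Set.Ioi 0).indicator fun x => ENNReal.ofReal (f x) := by
      ext x
      by_cases h : x ∈ Set.Ioi (0 : ℝ) <;> simp [h]
    rw [h2, withDensity_indicator measurableSet_Ioi, ← restrict_withDensity measurableSet_Ioi,
      ← hμf, h1]
  · rw [Set.indicator_of_mem (Set.mem_Ioi.2 hx)]
    refine HasSum.congr_fun (ha x hx) fun q => ?_
    have : (q ! : ℝ) ≠ 0 := by positivity
    rw [coeff_borelTransform, coeff_mk]
    field_simp

namespace IsPositiveDensity

variable {μ : Measure ℝ} [IsProbabilityMeasure μ] {f : ℝ → ℝ} {Φ : ℝ⟦X⟧}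

/-- Fubini and the substitution `z = c y`. Only the distribution function of `ν` enters, so sums can
be built up from the Dirac mass at `0`, whose series is `1`. -/
theorem cdf_conv_map_div (hμ : IsPositiveDensity μ f Φ) (ν : Measure ℝ) [IsProbabilityMeasure ν]
    {c : ℝ} (hc : 0 < c) (x : ℝ) :
    cdf (ν ∗ μ.map (· / c)) x = ∫ y, cdf ν (x - y) * (c * f (c * y)) := by
  have hdiv : Measurable fun z : ℝ => z / c := by fun_prop
  have := Measure.isProbabilityMeasure_map (μ := μ) hdiv.aemeasurable
  have hmono : Measurable fun y => cdf ν (x - y) :=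
    (monotone_cdf ν).measurable.comp (measurable_const.sub measurable_id)
  have h1 : cdf (ν ∗ μ.map (· / c)) x = ∫ y, cdf ν (x - y) ∂(μ.map (· / c)) := by
    rw [cdf_eq_real, measureReal_def, Measure.conv, Measure.map_apply (by fun_prop)
      measurableSet_Iic, Measure.prod_apply_symm (measurableSet_Iic.preimage (by fun_prop)),
      integral_eq_lintegral_of_nonneg_ae (ae_of_all _ fun y => cdf_nonneg ν _)
        hmono.aestronglyMeasurable]
    congr 1
    refine lintegral_congr fun y => ?_
    rw [ofReal_cdf]
    congr 1
    ext z
    simp [le_sub_iff_add_le]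
  rw [h1, integral_map hdiv.aemeasurable hmono.aestronglyMeasurable, hμ.eq_withDensity,
    integral_withDensity_eq_integral_toReal_smul hμ.measurable.ennreal_ofReal
      (ae_of_all _ fun _ => ENNReal.ofReal_lt_top)]
  have h2 := Measure.integral_comp_mul_left
    (fun z => (ENNReal.ofReal (f z)).toReal • cdf ν (x - z / c)) c
  rw [abs_of_pos (inv_pos.2 hc), smul_eq_mul] at h2
  rw [← mul_inv_cancel_left₀ hc.ne' (∫ z, _ • _), ← h2, ← integral_const_mul]
  refine integral_congr_ae (ae_of_all _ fun y => ?_)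
  simp only [ENNReal.toReal_ofReal (hμ.nonneg _), smul_eq_mul, mul_div_cancel_left₀ _ hc.ne']
  ring

theorem cdf_conv_map_div_of_neg (hμ : IsPositiveDensity μ f Φ) {ν : Measure ℝ}
    [IsProbabilityMeasure ν] (hν : ∀ x < 0, cdf ν x = 0) {c : ℝ} (hc : 0 < c) {x : ℝ}
    (hx : x < 0) : cdf (ν ∗ μ.map (· / c)) x = 0 := by
  rw [hμ.cdf_conv_map_div ν hc, ← integral_zero ℝ ℝ]
  refine integral_congr_ae (ae_of_all _ fun y => ?_)
  rcases le_or_gt y 0 with hy | hy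
  · simp [hμ.eq_zero (c * y) (mul_nonpos_of_nonneg_of_nonpos hc.le hy)]
  · simp [hν (x - y) (by linarith)]

theorem hasMaclaurinSeries_cdf_conv_map_div (hμ : IsPositiveDensity μ f Φ) {ν : Measure ℝ}
    [IsProbabilityMeasure ν] (hν : ∀ x < 0, cdf ν x = 0) {A : ℝ⟦X⟧}
    (hA : HasMaclaurinSeries (cdf ν) (borelTransform A)) {c : ℝ} (hc : 0 < c) :
    HasMaclaurinSeries (cdf (ν ∗ μ.map (· / c)))
      (borelTransform (A * (X * scaleDensity c Φ))) := by
  refine (hA.convolution (hμ.hasMaclaurinSeries.scale hc)).congr fun x hx => ?_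
  rw [hμ.cdf_conv_map_div ν hc, ← integral_Ioc_eq_integral_Ioo,
    ← integral_indicator measurableSet_Ioc]
  refine integral_congr_ae (ae_of_all _ fun y => ?_)
  by_cases hy : y ∈ Set.Ioc 0 x
  · simp only [Set.indicator_of_mem hy]
  · simp only [Set.indicator_of_notMem hy]
    rcases le_or_gt y 0 with hy0 | hy0
    · simp [hμ.eq_zero (c * y) (mul_nonpos_of_nonneg_of_nonpos hc.le hy0)]
    · have : x < y := not_le.1 fun h => hy ⟨hy0, h⟩
      simp [hν (x - y) (by linarith)]

theorem cdf_dirac_zero_of_neg {x : ℝ} (hx : x < 0) : cdf (Measure.dirac 0) x = 0 := by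
  rw [cdf_eq_real, measureReal_def, Measure.dirac_apply' _ measurableSet_Iic]
  simp [hx]

theorem hasMaclaurinSeries_cdf_dirac_zero :
    HasMaclaurinSeries (cdf (Measure.dirac 0)) (borelTransform 1) := by
  rw [borelTransform_one, ← map_one (C (R := ℝ))]
  refine (HasMaclaurinSeries.const 1).congr fun x hx => ?_
  rw [cdf_eq_real, measureReal_def, Measure.dirac_apply' _ measurableSet_Iic]
  simp [hx.le]

theorem hasMaclaurinSeries_cdf (hμ : IsPositiveDensity μ f Φ) :
    HasMaclaurinSeries (cdf μ) (borelTransform (X * Φ)) := by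
  simpa [scaleDensity] using hμ.hasMaclaurinSeries_cdf_conv_map_div
    (fun x hx => cdf_dirac_zero_of_neg hx) hasMaclaurinSeries_cdf_dirac_zero one_pos

theorem hasMaclaurinSeries_cdf_sum {Ω : Type*} [MeasurableSpace Ω] {P : Measure Ω}
    [IsProbabilityMeasure P] (hμ : IsPositiveDensity μ f Φ) {ι : Type*} {Y : ι → Ω → ℝ}
    (hlaw : ∀ i, HasLaw (Y i) μ P) (hindep : iIndepFun Y P) {c : ι → ℝ} (hc : ∀ i, 0 < c i)
    (s : Finset ι) :
    (∀ x < 0, cdf (P.map (∑ i ∈ s, fun ω => Y i ω / c i)) x = 0) ∧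
    HasMaclaurinSeries (cdf (P.map (∑ i ∈ s, fun ω => Y i ω / c i)))
      (borelTransform (∏ i ∈ s, X * scaleDensity (c i) Φ)) := by
  classical
  have hmeas : ∀ i, AEMeasurable (fun ω => Y i ω / c i) P := fun i =>
    (hlaw i).aemeasurable.div_const _
  have hind : iIndepFun (fun i ω => Y i ω / c i) P :=
    hindep.comp (fun i z => z / c i) fun i => by fun_prop
  have hdiv : ∀ i, P.map (fun ω => Y i ω / c i) = μ.map (· / c i) := fun i => by
    rw [← (hlaw i).map_eq, AEMeasurable.map_map_of_aemeasurable (by fun_prop)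
      (hlaw i).aemeasurable]
    rfl
  induction s using Finset.induction_on with
  | empty =>
    have h : P.map (∑ i ∈ (∅ : Finset ι), fun ω => Y i ω / c i) = Measure.dirac 0 := by
      rw [Finset.sum_empty]
      exact (Measure.map_const P (0 : ℝ)).trans (by simp)
    rw [h, Finset.prod_empty]
    exact ⟨fun x hx => cdf_dirac_zero_of_neg hx, hasMaclaurinSeries_cdf_dirac_zero⟩
  | insert j s hj ih =>
    have hsum : AEMeasurable (∑ i ∈ s, fun ω => Y i ω / c i) P :=
      Finset.aemeasurable_sum s fun i _ => hmeas i
    have := Measure.isProbabilityMeasure_map hsum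
    have h : P.map (∑ i ∈ insert j s, fun ω => Y i ω / c i) =
        P.map (∑ i ∈ s, fun ω => Y i ω / c i) ∗ μ.map (· / c j) := by
      rw [Finset.sum_insert hj, add_comm,
        (hind.indepFun_finsetSum_of_notMem₀ hmeas hj).map_add_eq_map_conv_map₀ hsum (hmeas j),
        hdiv]
    rw [h, Finset.prod_insert hj, mul_comm (X * _)]
    exact ⟨fun x hx => hμ.cdf_conv_map_div_of_neg ih.1 (hc j) hx,
      hμ.hasMaclaurinSeries_cdf_conv_map_div ih.1 ih.2 (hc j)⟩

theorem series_ne_zero (hμ : IsPositiveDensity μ f Φ) : Φ ≠ 0 := by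
  rintro rfl
  have hf : f = 0 := by
    ext x
    rcases le_or_gt x 0 with hx | hx
    · exact hμ.eq_zero x hx
    · refine (hμ.hasMaclaurinSeries x hx).unique ?_
      simp [coeff_borelTransform]
  have h := hμ.eq_withDensity
  simp only [hf, Pi.zero_apply, ENNReal.ofReal_zero, withDensity_const, zero_smul] at h
  exact IsProbabilityMeasure.ne_zero μ h

theorem exists_eq_expMeasure {a ρ : ℝ} (hμ : IsPositiveDensity μ f (geomSeries a ρ))
    (ha : a ≠ 0) : ∃ r : ℝ, 0 < r ∧ μ = expMeasure r := by
  have hf : ∀ x, 0 < x → f x = a * Real.exp (ρ * x) := fun x hx => by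
    refine (hμ.hasMaclaurinSeries x hx).unique ?_
    rw [Real.exp_eq_exp_ℝ]
    refine HasSum.congr_fun ((NormedSpace.expSeries_div_hasSum_exp (ρ * x)).mul_left a) fun q => ?_
    rw [coeff_borelTransform, coeff_geomSeries]
    ring
  have hapos : 0 < a := by
    refine lt_of_le_of_ne ?_ ha.symm
    have h := hμ.nonneg 1
    rw [hf 1 one_pos] at h
    exact nonneg_of_mul_nonneg_left h (Real.exp_pos _)
  have hρ : ρ < 0 := by
    by_contra! hρ
    have h1 : μ Set.univ = ⊤ := by
      rw [hμ.eq_withDensity, withDensity_apply _ MeasurableSet.univ, Measure.restrict_univ,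
        eq_top_iff]
      calc (⊤ : ENNReal) = ∫⁻ _ in Set.Ioi (0 : ℝ), ENNReal.ofReal a := by
            rw [setLIntegral_const, Real.volume_Ioi, ENNReal.mul_top]
            simpa using hapos
        _ ≤ ∫⁻ x in Set.Ioi (0 : ℝ), ENNReal.ofReal (f x) := by
            refine setLIntegral_mono hμ.measurable.ennreal_ofReal fun x hx => ?_
            refine ENNReal.ofReal_le_ofReal ?_
            rw [hf x hx]
            exact le_mul_of_one_le_right hapos.le
              (Real.one_le_exp (mul_nonneg hρ (le_of_lt hx)))
        _ ≤ _ := setLIntegral_le_lintegral _ _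
    rw [measure_univ] at h1
    exact ENNReal.one_ne_top h1
  have hr : 0 < -ρ := neg_pos.2 hρ
  have := isProbabilityMeasure_expMeasure hr
  refine ⟨-ρ, hr, ?_⟩
  -- Both measures are probabilities, so the scalar is `1` and `a` need not be computed.
  have hsmul : μ = ENNReal.ofReal (a / -ρ) • expMeasure (-ρ) := by
    have hpdf : Measurable (gammaPDF 1 (-ρ)) := (measurable_gammaPDFReal 1 _).ennreal_ofReal
    rw [hμ.eq_withDensity, expMeasure, gammaMeasure, ← withDensity_smul _ hpdf]
    refine withDensity_congr_ae ?_
    filter_upwards [Measure.ae_ne volume (0 : ℝ)] with x hx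
    change ENNReal.ofReal (f x) = ENNReal.ofReal (a / -ρ) * exponentialPDF (-ρ) x
    rcases lt_or_gt_of_ne hx with hx | hx
    · rw [exponentialPDF_of_neg hx, hμ.eq_zero x hx.le]; simp
    · rw [exponentialPDF_of_nonneg hx.le, hf x hx, ← ENNReal.ofReal_mul (by positivity)]
      congr 1
      have := hρ.ne
      field_simp
  have hmass := congrArg (fun m : Measure ℝ => m Set.univ) hsmul
  simp only [Measure.smul_apply, measure_univ, smul_eq_mul, mul_one] at hmass
  rw [hsmul, ← hmass, one_smul]

end IsPositiveDensity

end Density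

/-! ### The characterization. -/

theorem theorem3 {Ω : Type*} [MeasurableSpace Ω] (P : Measure Ω) [IsProbabilityMeasure P]
    (μ : Measure ℝ) [IsProbabilityMeasure μ] (hμ : HasMaclaurinDensity μ)
    (n k : ℕ) (hn : 2 ≤ n) (hk : 1 ≤ k) (hkn : k ≤ n)
    (X : Fin n → Ω → ℝ) (hlaw : ∀ i, HasLaw (X i) μ P) (hindep : iIndepFun X P)
    (hrep : IdentDistrib
      (fun ω => ∑ j : Fin k, X (Fin.castLE hkn j) ω / ((n : ℝ) - (j : ℕ)))
      (fun ω => orderStatistic (fun i => X i ω) ⟨k - 1, by omega⟩) P P) :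
    ∃ r : ℝ, 0 < r ∧ μ = expMeasure r := by
  obtain ⟨f, Φ, hΦ⟩ := hμ.exists_isPositiveDensity
  have hsum := (hΦ.hasMaclaurinSeries_cdf_sum (fun j => hlaw (Fin.castLE hkn j))
    (hindep.precomp (Fin.castLE_injective hkn)) (c := fun j : Fin k => (n : ℝ) - (j : ℕ))
    (fun j => sub_pos.2 (Nat.cast_lt.2 (j.2.trans_le hkn))) Finset.univ).2
  have hfun : (∑ j : Fin k, fun ω => X (Fin.castLE hkn j) ω / ((n : ℝ) - (j : ℕ))) =
      fun ω => ∑ j : Fin k, X (Fin.castLE hkn j) ω / ((n : ℝ) - (j : ℕ)) := by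
    ext ω; simp
  rw [hfun, hrep.map_eq] at hsum
  have hord := (hΦ.hasMaclaurinSeries_cdf.aeval (binomialTail n k)).congr
    (h := cdf (P.map fun ω => orderStatistic (fun i => X i ω) ⟨k - 1, by omega⟩)) fun x _ => by
      rw [cdf_map_orderStatistic hlaw hindep, Nat.sub_add_cancel hk]
  have heq := hsum.unique hord
  rw [Fin.prod_univ_eq_prod_range
    (fun j => PowerSeries.X * scaleDensity ((n : ℝ) - (j : ℕ)) Φ) k] at heq
  obtain ⟨a, ρ, ha, rfl⟩ :=
    exists_eq_geomSeries_of_borelTransform_prod_eq hn hk hkn hΦ.series_ne_zero heq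
  exact hΦ.exists_eq_expMeasure ha
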